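/- **Setting.** Let $\mathcal X,\mathcal Y$ be Polish spaces with their Borel $\sigma$-algebras, let $(\Omega,\mathcal F,\mathbb P)$ be a probability space, and let $(X_i)_{i\ge 1}$ be i.i.d. $\mathcal X$-valued random variables on it with atomless law $\mu\in\mathscr P(\mathcal X)$. Let $c:\mathcal X\times\mathcal Y\to[0,+\infty]$, $L:\mathcal Y\to[0,+\infty]$ and $H:\mathcal Y\times\mathcal Y\to[0,+\infty]$ be lower semicontinuous, with $H$ symmetric and $\{L\le\kappa\}$ compact for every real $\kappa>0$. For $\nu,\bar\nu\in\mathscr P(\mathcal Y)$ put $\mathcal L(\nu)=\int L\,d\nu$ and $\mathcal H(\nu,\bar\nu)=\int H\,d\nu\otimes\bar\nu$. **Random plans.** For a Polish space $\mathcal Z$, $\mathscr P_\Omega(\mathcal Z)$ is the set of random probability measures on $\mathcal Z$, i.e. of maps $\boldsymbol\gamma:\Omega\to\mathscr P(\mathcal Z)$ that are measurable for the Borel $\sigma$-algebra of the narrow topology of $\mathscr P(\mathcal Z)$. Its narrow topology is the weakest one that makes $\boldsymbol\gamma\mapsto\mathbb E\big[\int f(\omega,z)\,d\boldsymbol\gamma(\omega)(z)\big]$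 continuous for every $f:\Omega\times\mathcal Z\to\mathbb R$ such that $f(\omega,\cdot)$ is bounded and continuous for a.e. $\omega$, $f(\cdot,z)$ is measurable for every $z$, and $\omega\mapsto\sup_z|f(\omega,z)|$ is integrable. **Functionals.** For $N\ge1$, let $\mathscr P_{\Omega,N}$ be the set of $\boldsymbol\gamma\in\mathscr P_\Omega(\mathcal X\times\mathcal Y)$ such that, a.s., $\boldsymbol\gamma=\frac1N\sum_{i=1}^N\delta_{X_i}\otimes\nu_i^{X_i}$ for some families $(\nu_i^x)_{x\in\mathcal X}\subset\mathscr P(\mathcal Y)$, $i=1,\dots,N$, with $x\mapsto\nu_i^x(B)$ Borel for every Borel $B\subset\mathcal Y$. Define $$\mathcal J_{\Omega,N}(\boldsymbol\gamma)=\mathbb E\Big[\int c\,d\boldsymbol\gamma+\frac1N\sum_{i=1}^N\mathcal L(\nu_i^{X_i})+\frac1{N^2}\sum_{i\ne j}\mathcal H(\nu_i^{X_i},\nu_j^{X_j})\Big]$$ if $\boldsymbol\gamma\in\mathscr P_{\Omega,N}$ (the value does not depend on the choice of the families, because $\mu$ is atomless), and $\mathcal J_{\Omega,N}(\boldsymbol\gamma)=+\infty$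 otherwise. For $\gamma\in\mathscr P(\mathcal X\times\mathcal Y)$ with first marginal $\mu$ and second marginal $\nu$, let $$\mathcal J(\gamma)=\int c\,d\gamma+\mathcal L(\nu)+\mathcal H(\nu,\nu).$$ For $\boldsymbol\gamma\in\mathscr P_\Omega(\mathcal X\times\mathcal Y)$, let $\mathcal J_\Omega(\boldsymbol\gamma)=\mathcal J(\gamma)$ if $\boldsymbol\gamma=\gamma$ a.s. for some deterministic $\gamma\in\mathscr P(\mathcal X\times\mathcal Y)$ with first marginal $\mu$, and $\mathcal J_\Omega(\boldsymbol\gamma)=+\infty$ otherwise. **Theorem.** $\mathcal J_{\Omega,N}$ $\Gamma$-converges to $\mathcal J_\Omega$ as $N\to\infty$ in $\mathscr P_\Omega(\mathcal X\times\mathcal Y)$ with the narrow topology of random probability measures. That is: 1. whenever $\boldsymbol\gamma_N\to\boldsymbol\gamma$, one has $\mathcal J_\Omega(\boldsymbol\gamma)\le\liminf_{N\to\infty}\mathcal J_{\Omega,N}(\boldsymbol\gamma_N)$; 2. for every $\boldsymbol\gamma$ there is a sequence $\boldsymbol\gamma_N\to\boldsymbol\gamma$ with $\limsup_{N\to\infty}\mathcal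 J_{\Omega,N}(\boldsymbol\gamma_N)\le\mathcal J_\Omega(\boldsymbol\gamma)$. -/

import Mathlib

open MeasureTheory ProbabilityTheory Filter Topology
open scoped ENNReal NNReal

noncomputable section

namespace OpenLoop

/-- Random probability measures on `Z` over the probability space `(Ω, P)`: maps
`Ω → 𝒫(Z)` that are measurable for the Borel σ-algebra of the narrow topology of `𝒫(Z)`.
The base measure `P` is recorded in the type because the topology below depends on it. -/
structure RandomProb {Ω : Type*} [MeasurableSpace Ω] (P : Measure Ω)
    (Z : Type*) [TopologicalSpace Z] [MeasurableSpace Z] [OpensMeasurableSpace Z] where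
  /-- the underlying map -/
  toFun : Ω → ProbabilityMeasure Z
  measurable_toFun : @Measurable Ω (ProbabilityMeasure Z) _ (borel (ProbabilityMeasure Z)) toFun

/-- Random bounded continuous functions: almost surely bounded and continuous in the space
variable, measurable in `ω` for every point, and with integrable supremum norm. -/
structure IsRandomBoundedContinuous {Ω : Type*} [MeasurableSpace Ω] (P : Measure Ω)
    {Z : Type*} [TopologicalSpace Z] (f : Ω → Z → ℝ) : Prop where
  ae_continuous : ∀ᵐ ω ∂P, Continuous (f ω)
  ae_bounded : ∀ᵐ ω ∂P, ∃ C : ℝ, ∀ z, |f ω z| ≤ C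
  measurable : ∀ z, Measurable fun ω => f ω z
  integrable_norm : Integrable (fun ω => ⨆ z, |f ω z|) P

/-- The narrow topology of random probability measures: the weakest topology for which
`γ ↦ 𝔼[∫ f(ω, z) dγ(ω)(z)]` is continuous for every random bounded continuous function `f`. -/
instance RandomProb.narrowTopology {Ω : Type*} [MeasurableSpace Ω] (P : Measure Ω)
    (Z : Type*) [TopologicalSpace Z] [MeasurableSpace Z] [OpensMeasurableSpace Z] :
    TopologicalSpace (RandomProb P Z) :=
  ⨅ f : {f : Ω → Z → ℝ // IsRandomBoundedContinuous P f},
    TopologicalSpace.induced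
      (fun γ : RandomProb P Z => ∫ ω, ∫ z, f.1 ω z ∂(γ.toFun ω : Measure Z) ∂P)
      inferInstance

/-- (Sequential) `Γ`-convergence of a sequence of `[0, +∞]`-valued functionals. -/
def GammaConverges {E : Type*} [TopologicalSpace E] (F : ℕ → E → ℝ≥0∞) (F' : E → ℝ≥0∞) :
    Prop :=
  (∀ (x : E) (u : ℕ → E), Tendsto u atTop (𝓝 x) →
      F' x ≤ liminf (fun N => F N (u N)) atTop) ∧
    ∀ x : E, ∃ u : ℕ → E, Tendsto u atTop (𝓝 x) ∧
      limsup (fun N => F N (u N)) atTop ≤ F' x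

/-- Two independent variables with the same atomless law are almost surely distinct. -/
theorem ae_ne_of_indepFun {Ω X : Type*} [MeasurableSpace Ω] [MeasurableSpace X] {P : Measure Ω} [IsProbabilityMeasure P]
    [MeasurableEq X] [MeasurableSingletonClass X]
    {μ : Measure X} [IsProbabilityMeasure μ] [NullSingletonClass μ]
    {f g : Ω → X} (hf : Measurable f) (hg : Measurable g) (hfg : IndepFun f g P)
    (hμf : P.map f = μ) (hμg : P.map g = μ) : ∀ᵐ ω ∂P, f ω ≠ g ω := by
  have hprod := (indepFun_iff_map_prod_eq_prod_map_map hf.aemeasurable hg.aemeasurable).1 hfg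
  have hD : MeasurableSet {p : X × X | p.1 = p.2} := measurableSet_eq_fun measurable_fst
    measurable_snd
  have h0 : (μ.prod μ) {p : X × X | p.1 = p.2} = 0 := by
    rw [Measure.prod_apply hD]
    have : ∀ x : X, Prod.mk x ⁻¹' {p : X × X | p.1 = p.2} = {x} := by
      intro x; ext y; simp [eq_comm]
    simp [this]
  rw [hμf, hμg] at hprod
  rw [← hprod, Measure.map_apply (hf.prodMk hg) hD] at h0
  rw [ae_iff]
  simpa using h0

section Potentials

variable {Ω X Y : Type*} [MeasurableSpace Ω] [MeasurableSpace X] [MeasurableSpace Y]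

/-- The measure `(1/N) ∑ᵢ δ_{ξᵢ(ω)} ⊗ νᵢ^{ξᵢ(ω)}` on `X × Y`, for a sample `ξ` and a profile
`ν` of measurable families of measures on `Y`. -/
def inducedPlan (ξ : ℕ → Ω → X) {N : ℕ} (ν : Fin N → Kernel X Y) (ω : Ω) :
    Measure (X × Y) :=
  (N : ℝ≥0∞)⁻¹ • ∑ i : Fin N, (Measure.dirac (ξ i ω)).prod (ν i (ξ i ω))

variable [TopologicalSpace X] [TopologicalSpace Y] [OpensMeasurableSpace (X × Y)]

/-- The random plan `γ` is (almost surely) the plan induced by the strategy profile `ν`, where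
each `νᵢ` is a measurable family of probability measures. -/
def IsInducedBy {P : Measure Ω} (ξ : ℕ → Ω → X) {N : ℕ} (ν : Fin N → Kernel X Y)
    (γ : RandomProb P (X × Y)) : Prop :=
  (∀ i, IsMarkovKernel (ν i)) ∧
    ∀ᵐ ω ∂P, (γ.toFun ω : Measure (X × Y)) = inducedPlan ξ ν ω

/-- The expected cost
`𝔼[∫ c dγ + (1/N) ∑ᵢ 𝓛(νᵢ^{ξᵢ}) + (1/N²) ∑_{i ≠ j} 𝓗(νᵢ^{ξᵢ}, νⱼ^{ξⱼ})]`. -/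
def profileCost {P : Measure Ω} (ξ : ℕ → Ω → X) (c : X × Y → ℝ≥0∞) (L : Y → ℝ≥0∞)
    (H : Y × Y → ℝ≥0∞) {N : ℕ} (ν : Fin N → Kernel X Y) (γ : RandomProb P (X × Y)) : ℝ≥0∞ :=
  ∫⁻ ω, (∫⁻ z, c z ∂(γ.toFun ω : Measure (X × Y))
      + (N : ℝ≥0∞)⁻¹ * ∑ i : Fin N, ∫⁻ y, L y ∂(ν i (ξ i ω))
      + ((N : ℝ≥0∞) ^ 2)⁻¹ * ∑ i : Fin N, ∑ j ∈ Finset.univ.filter (fun j => j ≠ i),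
          ∫⁻ p, H p ∂((ν i (ξ i ω)).prod (ν j (ξ j ω)))) ∂P

/-- The open-loop potential `𝓙_{Ω,N}`: the expected cost if `γ` is induced by a strategy
profile, and `+∞` otherwise. The infimum over the inducing profiles only serves to
select one: the cost does not depend on the profile when the law of the sample is atomless
(`openLoopPotential_eq_profileCost`), and the infimum is `+∞` if there is none. -/
def openLoopPotential {P : Measure Ω} (ξ : ℕ → Ω → X) (c : X × Y → ℝ≥0∞) (L : Y → ℝ≥0∞)
    (H : Y × Y → ℝ≥0∞) (N : ℕ) (γ : RandomProb P (X × Y)) : ℝ≥0∞ :=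
  ⨅ (ν : Fin N → Kernel X Y) (_ : IsInducedBy ξ ν γ), profileCost ξ c L H ν γ

/-- The potential `𝓙(γ) = ∫ c dγ + ∫ L dν + ∬ H dν ⊗ ν` of the game with a continuum of players,
with `ν` the second marginal of `γ`, if the first marginal of `γ` is `μ`; `+∞` otherwise. -/
def continuumPotential (μ : Measure X) (c : X × Y → ℝ≥0∞) (L : Y → ℝ≥0∞) (H : Y × Y → ℝ≥0∞)
    (γ : ProbabilityMeasure (X × Y)) : ℝ≥0∞ :=
  open Classical in
  if (γ : Measure (X × Y)).map Prod.fst = μ then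
    ∫⁻ z, c z ∂(γ : Measure (X × Y))
      + ∫⁻ y, L y ∂((γ : Measure (X × Y)).map Prod.snd)
      + ∫⁻ p, H p ∂(((γ : Measure (X × Y)).map Prod.snd).prod
          ((γ : Measure (X × Y)).map Prod.snd))
  else ⊤

/-- The limit functional `𝓙_Ω`: it is `𝓙(γ₀)` if `γ` is almost surely equal to a deterministic
plan `γ₀` with first marginal `μ`, and `+∞` otherwise. (`γ₀` is unique if it exists; see
`limitPotential_of_ae_eq` and `limitPotential_eq_top`.) -/
def limitPotential {P : Measure Ω} (μ : Measure X) (c : X × Y → ℝ≥0∞) (L : Y → ℝ≥0∞)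
    (H : Y × Y → ℝ≥0∞) (γ : RandomProb P (X × Y)) : ℝ≥0∞ :=
  ⨅ (γ₀ : ProbabilityMeasure (X × Y)) (_ : (γ₀ : Measure (X × Y)).map Prod.fst = μ)
    (_ : ∀ᵐ ω ∂P, γ.toFun ω = γ₀), continuumPotential μ c L H γ₀

theorem limitPotential_of_ae_eq {P : Measure Ω} [IsProbabilityMeasure P] (μ : Measure X)
    (c : X × Y → ℝ≥0∞) (L : Y → ℝ≥0∞) (H : Y × Y → ℝ≥0∞) (γ : RandomProb P (X × Y))
    (γ₀ : ProbabilityMeasure (X × Y)) (hμ : (γ₀ : Measure (X × Y)).map Prod.fst = μ)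
    (h : ∀ᵐ ω ∂P, γ.toFun ω = γ₀) :
    limitPotential μ c L H γ = continuumPotential μ c L H γ₀ := by
  refine le_antisymm (iInf_le_of_le γ₀ (iInf_le_of_le hμ (iInf_le _ h))) ?_
  refine le_iInf fun γ₁ => le_iInf fun _ => le_iInf fun h₁ => ?_
  obtain ⟨ω, hω, hω₁⟩ := (h.and h₁).exists
  rw [← hω, ← hω₁]

theorem limitPotential_eq_top {P : Measure Ω} (μ : Measure X)
    (c : X × Y → ℝ≥0∞) (L : Y → ℝ≥0∞) (H : Y × Y → ℝ≥0∞) (γ : RandomProb P (X × Y))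
    (h : ¬ ∃ γ₀ : ProbabilityMeasure (X × Y), (γ₀ : Measure (X × Y)).map Prod.fst = μ ∧
      ∀ᵐ ω ∂P, γ.toFun ω = γ₀) :
    limitPotential μ c L H γ = ⊤ := by
  simp only [limitPotential, iInf_eq_top]
  exact fun γ₀ h₁ h₂ => absurd ⟨γ₀, h₁, h₂⟩ h

theorem openLoopPotential_eq_top {P : Measure Ω} (ξ : ℕ → Ω → X) (c : X × Y → ℝ≥0∞)
    (L : Y → ℝ≥0∞) (H : Y × Y → ℝ≥0∞) {N : ℕ} (γ : RandomProb P (X × Y))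
    (h : ¬ ∃ ν : Fin N → Kernel X Y, IsInducedBy ξ ν γ) :
    openLoopPotential ξ c L H N γ = ⊤ := by
  simp only [openLoopPotential, iInf_eq_top]
  exact fun ν h₁ => absurd ⟨ν, h₁⟩ h

/-- The potential does not depend on the profile that induces the plan. -/
theorem openLoopPotential_eq_profileCost {P : Measure Ω} [IsProbabilityMeasure P]
    [MeasurableEq X] [MeasurableSingletonClass X]
    {μ : Measure X} [IsProbabilityMeasure μ] [NullSingletonClass μ]
    (ξ : ℕ → Ω → X) (hξ : ∀ i, Measurable (ξ i)) (hlaw : ∀ i, P.map (ξ i) = μ)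
    (hind : iIndepFun ξ P) (c : X × Y → ℝ≥0∞) (L : Y → ℝ≥0∞) (H : Y × Y → ℝ≥0∞) {N : ℕ}
    (ν : Fin N → Kernel X Y) (γ : RandomProb P (X × Y)) (h : IsInducedBy ξ ν γ) :
    openLoopPotential ξ c L H N γ = profileCost ξ c L H ν γ := by
  refine le_antisymm (iInf_le_of_le ν (iInf_le _ h)) ?_
  refine le_iInf fun ν' => le_iInf fun h' => le_of_eq ?_
  have hne : ∀ᵐ ω ∂P, ∀ i j : Fin N, i ≠ j → ξ i ω ≠ ξ j ω := by
    refine ae_all_iff.2 fun i => ae_all_iff.2 fun j => ?_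
    by_cases hij : i = j
    · simp [hij]
    · have := ae_ne_of_indepFun (hξ i) (hξ j)
        (hind.indepFun (fun e => hij (Fin.ext e))) (hlaw i) (hlaw j)
      filter_upwards [this] with ω hω _ using hω
  have key : ∀ᵐ ω ∂P, ∀ i : Fin N, ν i (ξ i ω) = ν' i (ξ i ω) := by
    filter_upwards [hne, h.2, h'.2] with ω hω h1 h2 i
    have hN : (N : ℝ≥0∞) ≠ 0 := by
      have := i.pos
      exact_mod_cast this.ne'
    have hval : ∀ κ : Fin N → Kernel X Y, (∀ i, IsMarkovKernel (κ i)) → ∀ B : Set Y,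
        MeasurableSet B →
        inducedPlan ξ κ ω ({ξ i ω} ×ˢ B) = (N : ℝ≥0∞)⁻¹ * κ i (ξ i ω) B := by
      intro κ hκ B hB
      simp only [inducedPlan, Measure.smul_apply, Measure.finsetSum_apply, smul_eq_mul]
      congr 1
      rw [Finset.sum_eq_single i]
      · rw [Measure.prod_prod]
        simp
      · intro j _ hj
        rw [Measure.prod_prod, Measure.dirac_apply' _ (measurableSet_singleton _)]
        simp [hω j i hj]
      · simp
    ext B hB
    have := hval ν h.1 B hB
    rw [← h1, h2, hval ν' h'.1 B hB] at this
    exact ((ENNReal.mul_right_inj (ENNReal.inv_ne_zero.2 (ENNReal.natCast_ne_top N))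
      (ENNReal.inv_ne_top.2 hN)).1 this).symm
  refine lintegral_congr_ae ?_
  filter_upwards [key] with ω hω
  simp only [hω]

end Potentials

end OpenLoop

end

/-! Everything passes through the expectation of a random plan, an ordinary probability measure that
depends continuously on the plan.

Lower bound. For an induced plan, the integral of a bounded continuous `φ` is an average of `N`
independent variables bounded by `‖φ‖`, so its variance is at most `‖φ‖² / N`. Its covariance with
every event therefore vanishes as `N → ∞`. A limit whose integrals are uncorrelated with all events
is constant, equal to its mean (`RandomProb.ae_eq_mean`), and the first marginal `μ` passes to the
limit. The terms in `c` and `L` are linear in the plan, hence depend on the mean only. By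
independence the interaction term is the double integral of `H` against the mean tensored with
itself, except that the diagonal is missing (`profileCost_eq`). With `H` truncated at level `j` the
diagonal weighs at most `j / N`, so lower semicontinuity applies for fixed `j`, and monotone
convergence in `j` recovers `H`.

Upper bound. Disintegrate `γ₀ = μ ⊗ₘ κ` and let every player use `κ`. The strong law of large
numbers gives almost sure narrow convergence, dominated convergence turns it into convergence of
random measures, and the cost is at most that of `γ₀` because the missing diagonal only lowers it.
-/

noncomputable section

namespace OpenLoop

/-! ### Narrow topology: countable tests, measurability, lower semicontinuity -/

section Narrow

variable {Z : Type*} [TopologicalSpace Z] [MeasurableSpace Z]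

/-- A second countable space has a countable family of open sets that approximates every open set
from inside in measure, for all probability measures simultaneously. -/
theorem exists_countable_inner_approx [SecondCountableTopology Z] :
    ∃ 𝒰 : Set (Set Z), 𝒰.Countable ∧ (∀ U ∈ 𝒰, IsOpen U) ∧
      ∀ (ν : ProbabilityMeasure Z) (G : Set Z), IsOpen G → ∀ r : ℝ≥0, r < ν G →
        ∃ U ∈ 𝒰, U ⊆ G ∧ r < ν U := by
  let B := TopologicalSpace.countableBasis Z
  have hB : TopologicalSpace.IsTopologicalBasis B := TopologicalSpace.isBasis_countableBasis Z
  have hBc : B.Countable := TopologicalSpace.countable_countableBasis Z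
  -- Finite unions of basic open sets: still countably many, and continuity from below makes them
  -- exhaust the mass of any open set.
  refine ⟨(fun T : Set (Set Z) => ⋃₀ T) '' {T | T.Finite ∧ T ⊆ B},
    (Set.countable_ofPred_finite_subset hBc).image _, ?_, ?_⟩
  · rintro _ ⟨T, ⟨-, hT⟩, rfl⟩
    exact isOpen_sUnion fun t ht => hB.isOpen (hT ht)
  · intro ν G hG r hr
    obtain ⟨T, hT, hrT, hTG⟩ := ν.exists_lt_measure_biUnion_of_isOpen (S := B)
      (fun u hu x hx => by
        obtain ⟨s, hs, hxs, hsu⟩ := hB.exists_subset_of_mem_open hx hu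
        exact ⟨s, hs, (hB.isOpen hs).mem_nhds hxs, hsu⟩) hG hr
    refine ⟨⋃₀ (T : Set (Set Z)), ⟨T, ⟨T.finite_toSet, fun t ht => hT t ht⟩, rfl⟩, ?_, ?_⟩
    · rw [Set.sUnion_eq_biUnion]; exact hTG
    · rw [Set.sUnion_eq_biUnion]; exact hrT

/-- Narrow convergence follows from convergence on a family of sets that approximates open sets
from inside. -/
theorem tendsto_of_inner_approx [OpensMeasurableSpace Z] {ι : Type*} {l : Filter ι}
    [l.IsCountablyGenerated] {𝒰 : Set (Set Z)} {ν : ProbabilityMeasure Z}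
    {νs : ι → ProbabilityMeasure Z}
    (h𝒰 : ∀ G : Set Z, IsOpen G → ∀ r : ℝ≥0, r < ν G → ∃ U ∈ 𝒰, U ⊆ G ∧ r < ν U)
    (h : ∀ U ∈ 𝒰, ∀ r : ℝ≥0, r < ν U → ∀ᶠ i in l, r < νs i U) :
    Tendsto νs l (𝓝 ν) := by
  rcases l.eq_or_neBot with rfl | hl
  · simp
  refine tendsto_of_forall_isOpen_le_liminf fun G hG => ?_
  refine (le_liminf_iff (isCoboundedUnder_ge_of_le (x := 1) l (by simp))
    (by isBoundedDefault)).2 fun r hr => ?_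
  obtain ⟨U, hU, hUG, hrU⟩ := h𝒰 G hG r hr
  filter_upwards [h U hU r hrU] with i hi
  exact hi.trans_le (ProbabilityMeasure.apply_mono _ hUG)

/-- Evaluations on measurable sets determine Borel measurability of maps into `𝒫(Z)`. -/
theorem measurable_borel_probabilityMeasure [SecondCountableTopology Z] [OpensMeasurableSpace Z]
    {Ω : Type*} [MeasurableSpace Ω] {f : Ω → ProbabilityMeasure Z}
    (hf : ∀ B, MeasurableSet B → Measurable fun ω => (f ω : Measure Z) B) :
    @Measurable Ω (ProbabilityMeasure Z) _ (borel (ProbabilityMeasure Z)) f := by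
  obtain ⟨𝒰, h𝒰c, h𝒰o, h𝒰⟩ := exists_countable_inner_approx (Z := Z)
  let S : Set (Set (ProbabilityMeasure Z)) :=
    (fun p : Set Z × ℚ => {ν : ProbabilityMeasure Z | (p.2 : ℝ) < (ν p.1 : ℝ)}) ''
      (𝒰 ×ˢ Set.univ)
  have hS : S.Countable := (h𝒰c.prod Set.countable_univ).image _
  -- The auxiliary topology `τ` is second countable, so its Borel sets are generated by its subbasis
  -- `S`. As `τ` refines the narrow topology, narrow Borel sets lie in that σ-algebra, and only the
  -- countably many sets of `S` need checking.
  let τ : TopologicalSpace (ProbabilityMeasure Z) := TopologicalSpace.generateFrom S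
  have hle : τ ≤ ProbabilityMeasure.instTopologicalSpace := by
    refine le_of_nhds_le_nhds fun ν => ?_
    change Tendsto id (@nhds _ τ ν) (@nhds _ ProbabilityMeasure.instTopologicalSpace ν)
    have hsc : @SecondCountableTopology _ τ := ⟨⟨S, hS, rfl⟩⟩
    have hcg : (@nhds _ τ ν).IsCountablyGenerated := by
      have := @TopologicalSpace.SecondCountableTopology.to_firstCountableTopology _ τ hsc
      exact @FirstCountableTopology.nhds_generated_countable _ τ this ν
    refine @tendsto_of_inner_approx Z _ _ _ _ (@nhds _ τ ν) hcg 𝒰 ν id (h𝒰 ν) fun U hU r hr => ?_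
    obtain ⟨q, hq1, hq2⟩ := exists_rat_btwn (NNReal.coe_lt_coe.2 hr)
    have hopen : @IsOpen _ τ {ν : ProbabilityMeasure Z | (q : ℝ) < (ν U : ℝ)} :=
      TopologicalSpace.isOpen_generateFrom_of_mem ⟨(U, q), ⟨hU, Set.mem_univ _⟩, rfl⟩
    filter_upwards [@IsOpen.mem_nhds _ τ ν _ hopen hq2] with ν' hν'
    exact NNReal.coe_lt_coe.1 (hq1.trans hν')
  have hsc : @SecondCountableTopology _ τ := ⟨⟨S, hS, rfl⟩⟩
  have hborel : @borel _ τ = MeasurableSpace.generateFrom S :=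
    @borel_eq_generateFrom_of_subbasis _ S τ hsc rfl
  have hmono : @borel _ ProbabilityMeasure.instTopologicalSpace ≤ @borel _ τ := borel_anti hle
  have : @Measurable Ω _ _ (MeasurableSpace.generateFrom S) f := by
    refine measurable_generateFrom ?_
    rintro _ ⟨⟨U, q⟩, ⟨hU, -⟩, rfl⟩
    exact measurableSet_lt measurable_const (hf U (h𝒰o U hU).measurableSet).ennreal_toReal
  exact this.mono le_rfl (hmono.trans hborel.le)

/-- By the portmanteau theorem, evaluation at an open set is lower semicontinuous, hence Borel; open
sets form a generating π-system. -/
theorem measurable_toMeasure_of_measurable_borel [BorelSpace Z] [HasOuterApproxClosed Z]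
    {Ω : Type*} [MeasurableSpace Ω] {f : Ω → ProbabilityMeasure Z}
    (hf : @Measurable Ω (ProbabilityMeasure Z) _ (borel (ProbabilityMeasure Z)) f) :
    Measurable fun ω => (f ω : Measure Z) := by
  refine Measurable.measure_of_isPiSystem_of_isProbabilityMeasure (S := {s | IsOpen s})
    (BorelSpace.measurable_eq (α := Z)) isPiSystem_isOpen fun G hG => ?_
  have hlsc : LowerSemicontinuous fun ν : ProbabilityMeasure Z => (ν : Measure Z) G :=
    lowerSemicontinuous_iff_le_liminf.2 fun ν =>
      ProbabilityMeasure.le_liminf_measure_open_of_tendsto tendsto_id hG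
  borelize (ProbabilityMeasure Z)
  exact hlsc.measurable.comp hf

/-- The integral of a lower semicontinuous function is lower semicontinuous along narrowly
convergent sequences. -/
theorem lintegral_le_liminf_of_lowerSemicontinuous [BorelSpace Z] [HasOuterApproxClosed Z]
    {ν : ProbabilityMeasure Z} {νs : ℕ → ProbabilityMeasure Z} (h : Tendsto νs atTop (𝓝 ν))
    {f : Z → ℝ≥0∞} (hf : LowerSemicontinuous f) :
    ∫⁻ z, f z ∂(ν : Measure Z) ≤ liminf (fun k => ∫⁻ z, f z ∂(νs k : Measure Z)) atTop := by
  -- The layer-cake formula reduces the truncated function to its superlevel sets, which are open;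
  -- portmanteau applies at each level `t`, and Fatou's lemma integrates over `t`.
  have htrunc : ∀ n : ℕ, ∫⁻ z, min (f z) n ∂(ν : Measure Z) ≤
      liminf (fun k => ∫⁻ z, f z ∂(νs k : Measure Z)) atTop := by
    intro n
    let g : Z → ℝ := fun z => (min (f z) n).toReal
    have hfin : ∀ z, min (f z) n ≠ ∞ := fun z =>
      ne_top_of_le_ne_top (ENNReal.natCast_ne_top n) (min_le_right _ _)
    have hg : ∀ z, min (f z) n = ENNReal.ofReal (g z) := fun z =>
      (ENNReal.ofReal_toReal (hfin z)).symm
    have hg0 : 0 ≤ g := fun z => ENNReal.toReal_nonneg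
    have hgm : Measurable g := (hf.measurable.min measurable_const).ennreal_toReal
    have hopen : ∀ t : ℝ, 0 < t → IsOpen {z | t < g z} := by
      intro t ht
      have : {z | t < g z} = {z | ENNReal.ofReal t < f z} ∩ {z | ENNReal.ofReal t < n} := by
        ext z
        have := ENNReal.ofReal_lt_iff_lt_toReal ht.le (hfin z)
        simp only [Set.mem_ofPred_eq, Set.mem_inter_iff, ← lt_min_iff]
        exact this.symm
      rw [this]
      exact (hf.isOpen_preimage _).inter isOpen_const
    calc ∫⁻ z, min (f z) n ∂(ν : Measure Z)
        = ∫⁻ t in Set.Ioi (0 : ℝ), (ν : Measure Z) {z | t < g z} := by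
          simp_rw [hg]
          exact lintegral_eq_lintegral_meas_lt _ (Eventually.of_forall hg0) hgm.aemeasurable
      _ ≤ ∫⁻ t in Set.Ioi (0 : ℝ), liminf (fun k => (νs k : Measure Z) {z | t < g z}) atTop :=
          setLIntegral_mono' measurableSet_Ioi fun t ht =>
            ProbabilityMeasure.le_liminf_measure_open_of_tendsto h (hopen t ht)
      _ ≤ liminf (fun k => ∫⁻ t in Set.Ioi (0 : ℝ), (νs k : Measure Z) {z | t < g z}) atTop :=
          lintegral_liminf_le fun k => Antitone.measurable fun s t hst =>
            measure_mono fun z hz => lt_of_le_of_lt hst hz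
      _ = liminf (fun k => ∫⁻ z, min (f z) n ∂(νs k : Measure Z)) atTop := by
          congr 1 with k
          simp_rw [hg]
          exact (lintegral_eq_lintegral_meas_lt _ (Eventually.of_forall hg0)
            hgm.aemeasurable).symm
      _ ≤ _ := liminf_le_liminf (Eventually.of_forall fun k =>
          lintegral_mono fun z => min_le_left _ _)
  have hsup : ∀ z, f z = ⨆ n : ℕ, min (f z) n := fun z => by
    rw [← inf_iSup_eq, ENNReal.iSup_natCast, inf_top_eq]
  calc ∫⁻ z, f z ∂(ν : Measure Z) = ∫⁻ z, ⨆ n : ℕ, min (f z) n ∂(ν : Measure Z) := by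
        simp_rw [← hsup]
    _ = ⨆ n : ℕ, ∫⁻ z, min (f z) n ∂(ν : Measure Z) :=
        lintegral_iSup (fun n => hf.measurable.min measurable_const)
          (fun m n hmn z => min_le_min_left _ (by exact_mod_cast hmn))
    _ ≤ _ := iSup_le htrunc

end Narrow

/-! ### The mean of a random measure, and a criterion for being deterministic -/

section Mean

variable {Ω Z : Type*} [MeasurableSpace Ω] [TopologicalSpace Z] [MeasurableSpace Z] [BorelSpace Z]
  {P : Measure Ω}

/-- The measure `Q` is only finite, so that both `P` and its restrictions to events are covered. -/
theorem integral_snd_compProd {Q : Measure Ω} [IsFiniteMeasure Q] (κ : Kernel Ω Z)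
    [IsMarkovKernel κ] (φ : BoundedContinuousFunction Z ℝ) :
    ∫ z, φ z ∂(Q ⊗ₘ κ).snd = ∫ ω, ∫ z, φ z ∂(κ ω) ∂Q := by
  have hφ := φ.integrable (Q ⊗ₘ κ).snd
  rw [Measure.snd, integral_map measurable_snd.aemeasurable
    φ.continuous.measurable.aestronglyMeasurable, Measure.integral_compProd]
  exact (integrable_map_measure φ.continuous.measurable.aestronglyMeasurable
    measurable_snd.aemeasurable).1 hφ

theorem tendsto_randomProb_iff {ι : Type*} {l : Filter ι} {v : ι → RandomProb P Z}
    {γ : RandomProb P Z} :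
    Tendsto v l (𝓝 γ) ↔ ∀ f : Ω → Z → ℝ, IsRandomBoundedContinuous P f →
      Tendsto (fun k => ∫ ω, ∫ z, f ω z ∂((v k).toFun ω : Measure Z) ∂P) l
        (𝓝 (∫ ω, ∫ z, f ω z ∂(γ.toFun ω : Measure Z) ∂P)) := by
  simp only [nhds_iInf, nhds_induced, tendsto_iInf, tendsto_comap_iff, Subtype.forall]
  rfl

/-- Narrow convergence tests the integral of a bounded continuous function on an event. -/
theorem tendsto_setIntegral_of_tendsto [IsProbabilityMeasure P] {ι : Type*} {l : Filter ι}
    {v : ι → RandomProb P Z}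
    {γ : RandomProb P Z} (h : Tendsto v l (𝓝 γ)) {A : Set Ω} (hA : MeasurableSet A)
    (φ : BoundedContinuousFunction Z ℝ) :
    Tendsto (fun k => ∫ ω in A, ∫ z, φ z ∂((v k).toFun ω : Measure Z) ∂P) l
      (𝓝 (∫ ω in A, ∫ z, φ z ∂(γ.toFun ω : Measure Z) ∂P)) := by
  have hind : ∀ ω z, A.indicator (fun _ => φ z) ω = A.indicator (fun _ => (1 : ℝ)) ω * φ z := by
    intro ω z
    by_cases hω : ω ∈ A <;> simp [hω]
  have key := tendsto_randomProb_iff.1 h (fun ω z => A.indicator (fun _ => φ z) ω) {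
    ae_continuous := Eventually.of_forall fun ω => by
      simp_rw [hind]; exact continuous_const.mul φ.continuous
    ae_bounded := Eventually.of_forall fun ω => ⟨‖φ‖, fun z => by
      by_cases hω : ω ∈ A
      · simpa [hω] using φ.norm_coe_le_norm z
      · simp [hω]⟩
    measurable := fun z => measurable_const.indicator hA
    integrable_norm := by
      have : (fun ω => ⨆ z, |A.indicator (fun _ => φ z) ω|) =
          A.indicator (fun _ => ⨆ z, |φ z|) := by
        ext ω
        by_cases hω : ω ∈ A <;> simp [hω]
      rw [this]
      exact (integrable_const _).indicator hA }
  have hset : ∀ w : RandomProb P Z,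
      ∫ ω, ∫ z, A.indicator (fun _ => φ z) ω ∂(w.toFun ω : Measure Z) ∂P =
        ∫ ω in A, ∫ z, φ z ∂(w.toFun ω : Measure Z) ∂P := by
    intro w
    rw [← integral_indicator hA]
    congr 1 with ω
    by_cases hω : ω ∈ A <;> simp [hω]
  simpa only [hset] using key

variable [HasOuterApproxClosed Z]

/-- A random probability measure as a Markov kernel. -/
def RandomProb.kernel (γ : RandomProb P Z) : Kernel Ω Z where
  toFun ω := γ.toFun ω
  measurable' := measurable_toMeasure_of_measurable_borel γ.measurable_toFun

theorem RandomProb.kernel_apply (γ : RandomProb P Z) (ω : Ω) :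
    γ.kernel ω = (γ.toFun ω : Measure Z) := rfl

instance (γ : RandomProb P Z) : IsMarkovKernel γ.kernel :=
  ⟨fun ω => inferInstanceAs (IsProbabilityMeasure (γ.toFun ω : Measure Z))⟩

variable [IsProbabilityMeasure P]

/-- The expectation of a random probability measure. -/
def RandomProb.mean (γ : RandomProb P Z) : ProbabilityMeasure Z :=
  ⟨(P ⊗ₘ γ.kernel).snd, inferInstance⟩

theorem RandomProb.lintegral_mean (γ : RandomProb P Z) {f : Z → ℝ≥0∞} (hf : Measurable f) :
    ∫⁻ z, f z ∂(γ.mean : Measure Z) = ∫⁻ ω, ∫⁻ z, f z ∂(γ.toFun ω : Measure Z) ∂P := by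
  change ∫⁻ z, f z ∂(P ⊗ₘ γ.kernel).snd = _
  rw [Measure.snd, lintegral_map hf measurable_snd,
    Measure.lintegral_compProd (f := fun p => f p.2) (hf.comp measurable_snd)]
  rfl

theorem RandomProb.integral_mean (γ : RandomProb P Z) (φ : BoundedContinuousFunction Z ℝ) :
    ∫ z, φ z ∂(γ.mean : Measure Z) = ∫ ω, ∫ z, φ z ∂(γ.toFun ω : Measure Z) ∂P :=
  integral_snd_compProd γ.kernel φ

/-- Test functions that do not depend on `ω` see only the mean. -/
theorem tendsto_mean {ι : Type*} {l : Filter ι} {v : ι → RandomProb P Z}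
    {γ : RandomProb P Z} (h : Tendsto v l (𝓝 γ)) :
    Tendsto (fun k => (v k).mean) l (𝓝 γ.mean) := by
  refine ProbabilityMeasure.tendsto_iff_forall_integral_tendsto.2 fun φ => ?_
  simp_rw [RandomProb.integral_mean]
  simpa using tendsto_setIntegral_of_tendsto h MeasurableSet.univ φ

/-- A random probability measure is deterministic if its integrals are uncorrelated with all
events. -/
theorem RandomProb.ae_eq_mean [MeasurableSpace.CountableOrCountablyGenerated Ω Z]
    (γ : RandomProb P Z)
    (h : ∀ (A : Set Ω) (φ : BoundedContinuousFunction Z ℝ), MeasurableSet A →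
      ∫ ω in A, ∫ z, φ z ∂(γ.toFun ω : Measure Z) ∂P =
        P.real A * ∫ z, φ z ∂(γ.mean : Measure Z)) :
    ∀ᵐ ω ∂P, γ.toFun ω = γ.mean := by
  -- The hypothesis says that averaging over an event `A` gives `P A` times the mean; bounded
  -- continuous functions determine finite measures.
  have hA : ∀ A : Set Ω, MeasurableSet A →
      (P.restrict A ⊗ₘ γ.kernel).snd = P A • (γ.mean : Measure Z) := by
    intro A hA
    have : IsFiniteMeasure (P A • (γ.mean : Measure Z)) :=
      Measure.smul_finite _ (measure_ne_top P A)
    refine ext_of_forall_integral_eq_of_IsFiniteMeasure fun φ => ?_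
    rw [integral_snd_compProd, integral_smul_measure]
    exact h A φ hA
  -- Hence the joint law is a product on rectangles, and almost everywhere uniqueness of
  -- disintegrations makes the kernel constant.
  have hprod : P ⊗ₘ γ.kernel = P ⊗ₘ Kernel.const Ω (γ.mean : Measure Z) := by
    refine Measure.ext_prod fun {A B} hAm hB => ?_
    have := congrArg (fun m => m B) (hA A hAm)
    simp only [Measure.snd_apply hB, Measure.smul_apply, smul_eq_mul] at this
    rw [← Set.univ_prod, Measure.compProd_apply_prod MeasurableSet.univ hB] at this
    rw [Measure.compProd_apply_prod hAm hB, Measure.compProd_apply_prod hAm hB]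
    simp only [Measure.restrict_univ] at this
    rw [this]
    simp [mul_comm]
  filter_upwards [Kernel.ae_eq_of_compProd_eq hprod] with ω hω
  exact Subtype.ext hω

end Mean

/-- The correlation of a centered sum with an event is controlled by its variance. -/
theorem sq_setIntegral_sub_le_variance {Ω : Type*} [MeasurableSpace Ω] {P : Measure Ω}
    [IsProbabilityMeasure P] {S : Ω → ℝ} (hS : MemLp S 2 P) {A : Set Ω} (hA : MeasurableSet A) :
    (∫ ω in A, S ω ∂P - P.real A * ∫ ω, S ω ∂P) ^ 2 ≤ Var[S; P] := by
  set m := ∫ ω, S ω ∂P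
  have hD : MemLp (fun ω => S ω - m) 2 P := hS.sub (memLp_const m)
  have hY : MemLp (A.indicator fun ω => S ω - m) 2 P := hD.indicator hA
  have hint : Integrable S P := hS.integrable (by norm_num)
  have h1 : ∫ ω in A, S ω ∂P - P.real A * m = ∫ ω, A.indicator (fun ω => S ω - m) ω ∂P := by
    rw [integral_indicator hA, integral_sub hint.integrableOn (integrable_const m).integrableOn]
    simp
  -- Nonnegativity of this variance is the inequality `(𝔼 Z)² ≤ 𝔼 Z²` for `Z = 1_A (S - m)`.
  have h2 := variance_nonneg (A.indicator fun ω => S ω - m) P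
  rw [variance_eq_sub hY] at h2
  rw [h1, variance_eq_integral hS.aestronglyMeasurable.aemeasurable]
  refine (sub_nonneg.1 h2).trans ?_
  refine integral_mono hY.integrable_sq hD.integrable_sq fun ω => ?_
  by_cases hω : ω ∈ A
  · simp [hω, m]
  · simpa [hω, m] using sq_nonneg (S ω - m)

/-! ### Induced plans: mean, expected cost and variance -/

section Profiles

variable {Ω X Y : Type*} [MeasurableSpace X] [MeasurableSpace Y]

theorem lintegral_inducedPlan (ξ : ℕ → Ω → X) {N : ℕ} (ν : Fin N → Kernel X Y)
    [∀ i, IsMarkovKernel (ν i)] {f : X × Y → ℝ≥0∞} (hf : Measurable f) (ω : Ω) :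
    ∫⁻ z, f z ∂(inducedPlan ξ ν ω) =
      (N : ℝ≥0∞)⁻¹ * ∑ i : Fin N, ∫⁻ y, f (ξ i ω, y) ∂(ν i (ξ i ω)) := by
  rw [inducedPlan, lintegral_smul_measure, lintegral_finsetSum_measure, smul_eq_mul]
  congr 1
  refine Finset.sum_congr rfl fun i _ => ?_
  rw [lintegral_prod _ hf.aemeasurable, lintegral_dirac' _ hf.lintegral_prod_right']

theorem isProbabilityMeasure_inducedPlan (ξ : ℕ → Ω → X) {N : ℕ} (hN : N ≠ 0)
    (ν : Fin N → Kernel X Y) [∀ i, IsMarkovKernel (ν i)] (ω : Ω) :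
    IsProbabilityMeasure (inducedPlan ξ ν ω) := by
  constructor
  have := lintegral_inducedPlan ξ ν (f := fun _ => 1) measurable_const ω
  simp only [lintegral_const, measure_univ, one_mul, Finset.sum_const, Finset.card_univ,
    Fintype.card_fin, nsmul_eq_mul, mul_one] at this
  rw [this, ENNReal.inv_mul_cancel (by exact_mod_cast hN) (ENNReal.natCast_ne_top N)]

variable [MeasurableSpace Ω]

theorem measurable_inducedPlan_apply {ξ : ℕ → Ω → X} (hξ : ∀ i, Measurable (ξ i)) {N : ℕ}
    (ν : Fin N → Kernel X Y) [∀ i, IsMarkovKernel (ν i)] {B : Set (X × Y)}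
    (hB : MeasurableSet B) : Measurable fun ω => inducedPlan ξ ν ω B := by
  have : ∀ ω, inducedPlan ξ ν ω B =
      (N : ℝ≥0∞)⁻¹ * ∑ i : Fin N, ∫⁻ y, B.indicator 1 (ξ i ω, y) ∂(ν i (ξ i ω)) := fun ω => by
    rw [← lintegral_inducedPlan ξ ν (measurable_one.indicator hB) ω, lintegral_indicator_one hB]
  simp_rw [this]
  refine (Finset.measurable_fun_sum _ fun i _ => ?_).const_mul _
  have h1 : Measurable fun x => ∫⁻ y, B.indicator (1 : X × Y → ℝ≥0∞) (x, y) ∂(ν i x) :=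
    (measurable_one.indicator hB).lintegral_kernel_prod_right'
  exact h1.comp (hξ i)

/-- For independent samples `x`, `x'` with law `μ`, the expected product integral against two
kernels is the product integral against the averaged joint laws. -/
theorem lintegral_prod_kernel_of_indepFun {P : Measure Ω} [IsProbabilityMeasure P]
    {μ : Measure X} [IsProbabilityMeasure μ] {f g : Ω → X} (hf : Measurable f)
    (hg : Measurable g) (hfg : IndepFun f g P) (hμf : P.map f = μ) (hμg : P.map g = μ)
    (κ η : Kernel X Y) [IsMarkovKernel κ] [IsMarkovKernel η] {H : Y × Y → ℝ≥0∞}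
    (hH : Measurable H) :
    ∫⁻ ω, ∫⁻ p, H p ∂((κ (f ω)).prod (η (g ω))) ∂P =
      ∫⁻ z, ∫⁻ z', H (z.2, z'.2) ∂(μ ⊗ₘ η) ∂(μ ⊗ₘ κ) := by
  have hprod := (indepFun_iff_map_prod_eq_prod_map_map hf.aemeasurable hg.aemeasurable).1 hfg
  rw [hμf, hμg] at hprod
  have hη : Measurable fun q : X × Y => ∫⁻ y', H (q.2, y') ∂(η q.1) :=
    Measurable.lintegral_kernel_prod_right' (κ := η.comap Prod.fst measurable_fst)
      (f := fun p : (X × Y) × Y => H (p.1.2, p.2)) (by fun_prop)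
  have hG : Measurable fun p : X × X => ∫⁻ y, ∫⁻ y', H (y, y') ∂(η p.2) ∂(κ p.1) :=
    Measurable.lintegral_kernel_prod_right' (κ := κ.comap Prod.fst measurable_fst)
      (f := fun p : (X × X) × Y => ∫⁻ y', H (p.2, y') ∂(η p.1.2))
      (hη.comp (g := fun q : X × Y => ∫⁻ y', H (q.2, y') ∂(η q.1))
        (f := fun p : (X × X) × Y => (p.1.2, p.2)) (by fun_prop))
  have hinner : Measurable fun z : X × Y => ∫⁻ z', H (z.2, z'.2) ∂(μ ⊗ₘ η) :=
    Measurable.lintegral_prod_right' (f := fun p : (X × Y) × (X × Y) => H (p.1.2, p.2.2))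
      (by fun_prop)
  calc ∫⁻ ω, ∫⁻ p, H p ∂((κ (f ω)).prod (η (g ω))) ∂P
      = ∫⁻ ω, (fun p : X × X => ∫⁻ y, ∫⁻ y', H (y, y') ∂(η p.2) ∂(κ p.1)) (f ω, g ω) ∂P := by
        refine lintegral_congr fun ω => ?_
        rw [lintegral_prod _ hH.aemeasurable]
    _ = ∫⁻ p, ∫⁻ y, ∫⁻ y', H (y, y') ∂(η p.2) ∂(κ p.1) ∂(μ.prod μ) := by
        rw [← hprod, lintegral_map hG (hf.prodMk hg)]
    _ = ∫⁻ x, ∫⁻ x', ∫⁻ y, ∫⁻ y', H (y, y') ∂(η x') ∂(κ x) ∂μ ∂μ :=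
        lintegral_prod _ hG.aemeasurable
    -- Exchanging `x'` and `y` groups each sample with its own response, so that the two joint laws
    -- appear.
    _ = ∫⁻ x, ∫⁻ y, ∫⁻ x', ∫⁻ y', H (y, y') ∂(η x') ∂μ ∂(κ x) ∂μ := by
        refine lintegral_congr fun x => ?_
        exact lintegral_lintegral_swap (hη.comp measurable_id).aemeasurable
    _ = ∫⁻ x, ∫⁻ y, ∫⁻ z', H (y, z'.2) ∂(μ ⊗ₘ η) ∂(κ x) ∂μ := by
        refine lintegral_congr fun x => lintegral_congr fun y => ?_
        rw [Measure.lintegral_compProd (f := fun z' => H (y, z'.2)) (by fun_prop)]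
    _ = _ := by rw [Measure.lintegral_compProd hinner]

/-- With no players the empty sum is the zero measure, which is not a probability. -/
theorem IsInducedBy.ne_zero [TopologicalSpace X] [TopologicalSpace Y]
    [OpensMeasurableSpace (X × Y)] {P : Measure Ω} [IsProbabilityMeasure P] {ξ : ℕ → Ω → X} {N : ℕ}
    {ν : Fin N → Kernel X Y} {γ : RandomProb P (X × Y)}
    (h : IsInducedBy ξ ν γ) : N ≠ 0 := by
  rintro rfl
  obtain ⟨ω, hω⟩ := h.2.exists
  have := congrArg (fun m => m Set.univ) hω
  simp [inducedPlan] at this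

variable [TopologicalSpace X] [PolishSpace X] [BorelSpace X]
  [TopologicalSpace Y] [PolishSpace Y] [BorelSpace Y]
  {P : Measure Ω} [IsProbabilityMeasure P] {μ : Measure X} [IsProbabilityMeasure μ]
  {ξ : ℕ → Ω → X}

/-- The expectation of an induced plan is the average of the joint laws. -/
theorem IsInducedBy.mean_eq (hξ : ∀ i, Measurable (ξ i)) (hlaw : ∀ i, P.map (ξ i) = μ) {N : ℕ}
    {ν : Fin N → Kernel X Y} {γ : RandomProb P (X × Y)} (h : IsInducedBy ξ ν γ) :
    (γ.mean : Measure (X × Y)) = (N : ℝ≥0∞)⁻¹ • ∑ i : Fin N, μ ⊗ₘ (ν i) := by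
  have := h.1
  refine Measure.ext_of_lintegral _ fun f hf => ?_
  rw [γ.lintegral_mean hf, lintegral_smul_measure, lintegral_finsetSum_measure, smul_eq_mul]
  have hm : ∀ i : Fin N, Measurable fun x => ∫⁻ y, f (x, y) ∂(ν i x) := fun i =>
    hf.lintegral_kernel_prod_right'
  calc ∫⁻ ω, ∫⁻ z, f z ∂(γ.toFun ω : Measure (X × Y)) ∂P
      = ∫⁻ ω, (N : ℝ≥0∞)⁻¹ * ∑ i : Fin N, ∫⁻ y, f (ξ i ω, y) ∂(ν i (ξ i ω)) ∂P := by
        refine lintegral_congr_ae ?_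
        filter_upwards [h.2] with ω hω
        rw [hω, lintegral_inducedPlan ξ ν hf]
    _ = (N : ℝ≥0∞)⁻¹ * ∑ i : Fin N, ∫⁻ ω, ∫⁻ y, f (ξ i ω, y) ∂(ν i (ξ i ω)) ∂P := by
        have hmξ : ∀ i : Fin N, Measurable fun ω => ∫⁻ y, f (ξ i ω, y) ∂(ν i (ξ i ω)) :=
          fun i => (hm i).comp (hξ i)
        rw [lintegral_const_mul _ (Finset.measurable_fun_sum _ fun i _ => hmξ i),
          lintegral_finsetSum _ fun i _ => hmξ i]
    _ = _ := by
        congr 1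
        refine Finset.sum_congr rfl fun i _ => ?_
        rw [Measure.lintegral_compProd hf, ← hlaw i, lintegral_map (hm i) (hξ i)]

/-- The expected cost of a profile in terms of its joint laws. -/
theorem profileCost_eq (hξ : ∀ i, Measurable (ξ i)) (hind : iIndepFun ξ P)
    (hlaw : ∀ i, P.map (ξ i) = μ) {c : X × Y → ℝ≥0∞} (hc : Measurable c) {L : Y → ℝ≥0∞}
    (hL : Measurable L) {H : Y × Y → ℝ≥0∞} (hH : Measurable H) {N : ℕ}
    {ν : Fin N → Kernel X Y} {γ : RandomProb P (X × Y)} (h : IsInducedBy ξ ν γ) :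
    profileCost ξ c L H ν γ =
      ∫⁻ z, c z ∂(γ.mean : Measure (X × Y)) + ∫⁻ z, L z.2 ∂(γ.mean : Measure (X × Y))
        + ((N : ℝ≥0∞) ^ 2)⁻¹ * ∑ i : Fin N, ∑ j ∈ Finset.univ.filter (fun j => j ≠ i),
          ∫⁻ z, ∫⁻ z', H (z.2, z'.2) ∂(μ ⊗ₘ ν j) ∂(μ ⊗ₘ ν i) := by
  have := h.1
  have hLm : Measurable fun z : X × Y => L z.2 := hL.comp measurable_snd
  have hcγ : Measurable fun ω => ∫⁻ z, c z ∂(γ.toFun ω : Measure (X × Y)) :=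
    hc.lintegral_kernel (κ := γ.kernel)
  have hLγ : ∀ᵐ ω ∂P, (N : ℝ≥0∞)⁻¹ * ∑ i : Fin N, ∫⁻ y, L y ∂(ν i (ξ i ω)) =
      ∫⁻ z, L z.2 ∂(γ.toFun ω : Measure (X × Y)) := by
    filter_upwards [h.2] with ω hω
    rw [hω, lintegral_inducedPlan ξ ν hLm]
  have hLm' : Measurable fun ω => ∫⁻ z, L z.2 ∂(γ.toFun ω : Measure (X × Y)) :=
    hLm.lintegral_kernel (κ := γ.kernel)
  have hHm : ∀ i j : Fin N, Measurable fun ω =>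
      ∫⁻ p, H p ∂((ν i (ξ i ω)).prod (ν j (ξ j ω))) := by
    intro i j
    have h1 : Measurable fun p : X × X =>
        ∫⁻ q, H q ∂(((ν i).prodMkRight X ×ₖ (ν j).prodMkLeft X) p) := hH.lintegral_kernel
    simp only [Kernel.prod_apply, Kernel.prodMkRight_apply, Kernel.prodMkLeft_apply] at h1
    exact h1.comp ((hξ i).prodMk (hξ j))
  calc profileCost ξ c L H ν γ
      = ∫⁻ ω, (∫⁻ z, c z ∂(γ.toFun ω : Measure (X × Y))
          + ∫⁻ z, L z.2 ∂(γ.toFun ω : Measure (X × Y))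
          + ((N : ℝ≥0∞) ^ 2)⁻¹ * ∑ i : Fin N, ∑ j ∈ Finset.univ.filter (fun j => j ≠ i),
            ∫⁻ p, H p ∂((ν i (ξ i ω)).prod (ν j (ξ j ω)))) ∂P := by
        refine lintegral_congr_ae ?_
        filter_upwards [hLγ] with ω hω
        rw [hω]
    _ = _ := by
        have hcL : Measurable fun ω => ∫⁻ z, c z ∂(γ.toFun ω : Measure (X × Y))
          + ∫⁻ z, L z.2 ∂(γ.toFun ω : Measure (X × Y)) := hcγ.add hLm'
        rw [lintegral_add_left hcL, lintegral_add_left hcγ, γ.lintegral_mean hc,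
          γ.lintegral_mean hLm, lintegral_const_mul _ (Finset.measurable_fun_sum _ fun i _ =>
            Finset.measurable_fun_sum _ fun j _ => hHm i j),
          lintegral_finsetSum _ fun i _ => Finset.measurable_fun_sum _ fun j _ => hHm i j]
        congr 2
        refine Finset.sum_congr rfl fun i _ => ?_
        rw [lintegral_finsetSum _ fun j _ => hHm i j]
        refine Finset.sum_congr rfl fun j hj => ?_
        -- Only off-diagonal pairs occur, and these are the pairs with independent samples.
        have hij : (i : ℕ) ≠ j := fun e => (Finset.mem_filter.1 hj).2 (Fin.ext e.symm)
        exact lintegral_prod_kernel_of_indepFun (hξ i) (hξ j) (hind.indepFun hij) (hlaw i)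
          (hlaw j) (ν i) (ν j) hH

theorem IsInducedBy.map_fst_mean (hξ : ∀ i, Measurable (ξ i)) (hlaw : ∀ i, P.map (ξ i) = μ)
    {N : ℕ} {ν : Fin N → Kernel X Y} {γ : RandomProb P (X × Y)} (h : IsInducedBy ξ ν γ) :
    (γ.mean : Measure (X × Y)).map Prod.fst = μ := by
  have := h.1
  have hN : (N : ℝ≥0∞) ≠ 0 := by exact_mod_cast h.ne_zero
  ext B hB
  rw [Measure.map_apply measurable_fst hB, h.mean_eq hξ hlaw, Measure.smul_apply,
    Measure.finsetSum_apply]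
  have : ∀ i : Fin N, (μ ⊗ₘ ν i) (Prod.fst ⁻¹' B) = μ B := fun i => by
    rw [← Measure.fst_apply hB, Measure.fst_compProd]
  simp only [this, Finset.sum_const, Finset.card_univ, Fintype.card_fin, nsmul_eq_mul,
    smul_eq_mul]
  rw [← mul_assoc, ENNReal.inv_mul_cancel hN (ENNReal.natCast_ne_top N), one_mul]

/-- The self-interaction energy of the mean plan exceeds the interaction cost by at most the
diagonal terms. -/
theorem IsInducedBy.lintegral_mean_mean_le (hξ : ∀ i, Measurable (ξ i))
    (hlaw : ∀ i, P.map (ξ i) = μ) {G : Y × Y → ℝ≥0∞} (hG : Measurable G) {C : ℝ≥0∞}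
    (hC : ∀ p, G p ≤ C) {N : ℕ} {ν : Fin N → Kernel X Y} {γ : RandomProb P (X × Y)}
    (h : IsInducedBy ξ ν γ) :
    ∫⁻ z, ∫⁻ z', G (z.2, z'.2) ∂(γ.mean : Measure (X × Y)) ∂(γ.mean : Measure (X × Y)) ≤
      ((N : ℝ≥0∞) ^ 2)⁻¹ * ∑ i : Fin N, ∑ j ∈ Finset.univ.filter (fun j => j ≠ i),
          ∫⁻ z, ∫⁻ z', G (z.2, z'.2) ∂(μ ⊗ₘ ν j) ∂(μ ⊗ₘ ν i) + C * (N : ℝ≥0∞)⁻¹ := by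
  have := h.1
  have hN : (N : ℝ≥0∞) ≠ 0 := by exact_mod_cast h.ne_zero
  have hN' : (N : ℝ≥0∞) ≠ ∞ := ENNReal.natCast_ne_top N
  have hmeas : ∀ j : Fin N, Measurable fun z : X × Y => ∫⁻ z', G (z.2, z'.2) ∂(μ ⊗ₘ ν j) :=
    fun j => Measurable.lintegral_prod_right'
      (f := fun p : (X × Y) × (X × Y) => G (p.1.2, p.2.2)) (by fun_prop)
  rw [h.mean_eq hξ hlaw]
  simp only [lintegral_smul_measure, lintegral_finsetSum_measure, smul_eq_mul]
  have e1 : ∀ i : Fin N, ∫⁻ z, (N : ℝ≥0∞)⁻¹ * ∑ j : Fin N, ∫⁻ z', G (z.2, z'.2) ∂(μ ⊗ₘ ν j)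
      ∂(μ ⊗ₘ ν i) = (N : ℝ≥0∞)⁻¹ * ∑ j : Fin N,
        ∫⁻ z, ∫⁻ z', G (z.2, z'.2) ∂(μ ⊗ₘ ν j) ∂(μ ⊗ₘ ν i) := fun i => by
    rw [lintegral_const_mul _ (Finset.measurable_fun_sum _ fun j _ => hmeas j),
      lintegral_finsetSum _ fun j _ => hmeas j]
  simp_rw [e1]
  rw [← Finset.mul_sum, ← mul_assoc, ← ENNReal.mul_inv (Or.inl hN) (Or.inl hN'), ← pow_two]
  -- Each row of the full double sum has one extra term, the diagonal one, of size at most `C`. The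
  -- `N` rows with weight `1 / N²` give `C / N`.
  have e2 : ∀ i : Fin N, ∑ j : Fin N, ∫⁻ z, ∫⁻ z', G (z.2, z'.2) ∂(μ ⊗ₘ ν j) ∂(μ ⊗ₘ ν i) ≤
      ∑ j ∈ Finset.univ.filter (fun j => j ≠ i),
        ∫⁻ z, ∫⁻ z', G (z.2, z'.2) ∂(μ ⊗ₘ ν j) ∂(μ ⊗ₘ ν i) + C := fun i => by
    rw [← Finset.sum_filter_add_sum_filter_not Finset.univ (fun j => j ≠ i)]
    gcongr
    simp only [not_not, Finset.filter_eq', Finset.mem_univ, if_true, Finset.sum_singleton]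
    calc ∫⁻ z, ∫⁻ z', G (z.2, z'.2) ∂(μ ⊗ₘ ν i) ∂(μ ⊗ₘ ν i)
        ≤ ∫⁻ _, ∫⁻ _, C ∂(μ ⊗ₘ ν i) ∂(μ ⊗ₘ ν i) :=
          lintegral_mono fun z => lintegral_mono fun z' => hC _
      _ = C := by simp
  refine (mul_le_mul_right (Finset.sum_le_sum fun i _ => e2 i) _).trans (le_of_eq ?_)
  rw [Finset.sum_add_distrib, mul_add]
  congr 1
  simp only [Finset.sum_const, Finset.card_univ, Fintype.card_fin, nsmul_eq_mul]
  rw [pow_two, ENNReal.mul_inv (Or.inl hN) (Or.inl hN'), ← mul_assoc, mul_assoc _ _ (N : ℝ≥0∞),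
    ENNReal.inv_mul_cancel hN hN', mul_one, mul_comm]

/-- The integrals of an induced plan decorrelate from all events as the number of players grows. -/
theorem IsInducedBy.sq_setIntegral_sub_le (hξ : ∀ i, Measurable (ξ i)) (hind : iIndepFun ξ P)
    {N : ℕ} {ν : Fin N → Kernel X Y} {γ : RandomProb P (X × Y)} (h : IsInducedBy ξ ν γ)
    (φ : BoundedContinuousFunction (X × Y) ℝ) {A : Set Ω} (hA : MeasurableSet A) :
    (∫ ω in A, ∫ z, φ z ∂(γ.toFun ω : Measure (X × Y)) ∂P
        - P.real A * ∫ z, φ z ∂(γ.mean : Measure (X × Y))) ^ 2 ≤ ‖φ‖ ^ 2 * (N : ℝ)⁻¹ := by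
  have := h.1
  have hφm : StronglyMeasurable φ := φ.continuous.measurable.stronglyMeasurable
  let g : Fin N → X → ℝ := fun i x => ∫ y, φ (x, y) ∂(ν i x)
  have hgm : ∀ i, Measurable (g i) := fun i => hφm.integral_kernel_prod_right'.measurable
  have hgb : ∀ i x, |g i x| ≤ ‖φ‖ := fun i x => by
    have := norm_integral_le_of_norm_le_const (μ := ν i x) (f := fun y => φ (x, y))
      (Eventually.of_forall fun y => φ.norm_coe_le_norm (x, y))
    simpa using this
  have hgL : ∀ i : Fin N, MemLp (fun ω => g i (ξ i ω)) 2 P := fun i =>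
    MemLp.of_bound ((hgm i).comp (hξ i)).aestronglyMeasurable ‖φ‖
      (Eventually.of_forall fun ω => hgb i _)
  let S : Ω → ℝ := fun ω => (N : ℝ)⁻¹ * (∑ i : Fin N, fun ω => g i (ξ i ω)) ω
  have hS : ∀ᵐ ω ∂P, ∫ z, φ z ∂(γ.toFun ω : Measure (X × Y)) = S ω := by
    filter_upwards [h.2] with ω hω
    rw [hω, inducedPlan, integral_smul_measure, integral_finsetSum_measure
      fun i _ => φ.integrable _]
    simp only [S, Finset.sum_apply, smul_eq_mul, ENNReal.toReal_inv, ENNReal.toReal_natCast]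
    congr 1
    refine Finset.sum_congr rfl fun i _ => ?_
    rw [integral_prod _ (φ.integrable _), integral_dirac' _ _
      hφm.integral_prod_right']
  have hSL : MemLp S 2 P := (memLp_finsetSum' _ fun i _ => hgL i).const_mul _
  have hvar : Var[S; P] ≤ ‖φ‖ ^ 2 * (N : ℝ)⁻¹ := by
    have hN : (N : ℝ) ≠ 0 := by exact_mod_cast h.ne_zero
    rw [variance_const_mul, IndepFun.variance_sum (fun i _ => hgL i) fun i _ j _ hij =>
      (hind.indepFun fun e => hij (Fin.ext e)).comp (hgm i) (hgm j)]
    calc ((N : ℝ)⁻¹) ^ 2 * ∑ i : Fin N, Var[fun ω => g i (ξ i ω); P]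
        ≤ ((N : ℝ)⁻¹) ^ 2 * ∑ _i : Fin N, ‖φ‖ ^ 2 := by
          gcongr with i
          -- Popoviciu's inequality: values in `[-‖φ‖, ‖φ‖]` have variance at most the square of the
          -- half-width, `‖φ‖²`.
          refine (variance_le_sq_of_bounded (a := -‖φ‖) (b := ‖φ‖)
            (Eventually.of_forall fun ω => abs_le.1 (hgb i _))
            (hgL i).aestronglyMeasurable.aemeasurable).trans (le_of_eq (by ring))
      _ = ‖φ‖ ^ 2 * (N : ℝ)⁻¹ := by
          simp only [Finset.sum_const, Finset.card_univ, Fintype.card_fin, nsmul_eq_mul]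
          field_simp
  rw [γ.integral_mean, integral_congr_ae hS, integral_congr_ae (ae_restrict_of_ae hS)]
  exact (sq_setIntegral_sub_le_variance hSL hA).trans hvar

end Profiles

/-! ### The continuum energy as an integral over pairs -/

section Energy

variable {X Y : Type*} [MeasurableSpace X] [MeasurableSpace Y]

/-- Gathering the three terms under a single integral against `M ⊗ M` lets one application of lower
semicontinuity treat them together. -/
theorem lintegral_prod_energy {c : X × Y → ℝ≥0∞} (hc : Measurable c) {L : Y → ℝ≥0∞}
    (hL : Measurable L) {G : Y × Y → ℝ≥0∞} (hG : Measurable G) (M : ProbabilityMeasure (X × Y)) :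
    ∫⁻ p, (c p.1 + L p.1.2 + G (p.1.2, p.2.2)) ∂(M.prod M : Measure ((X × Y) × (X × Y))) =
      ∫⁻ z, c z ∂(M : Measure (X × Y)) + ∫⁻ z, L z.2 ∂(M : Measure (X × Y))
        + ∫⁻ z, ∫⁻ z', G (z.2, z'.2) ∂(M : Measure (X × Y)) ∂(M : Measure (X × Y)) := by
  have hcL : Measurable fun z : X × Y => c z + L z.2 := hc.add (hL.comp measurable_snd)
  rw [ProbabilityMeasure.toMeasure_prod, lintegral_prod _ (by fun_prop)]
  simp only [lintegral_add_left measurable_const, lintegral_const, measure_univ, mul_one]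
  rw [lintegral_add_left hcL, lintegral_add_left hc]

theorem continuumPotential_eq [TopologicalSpace X] [TopologicalSpace Y]
    [OpensMeasurableSpace (X × Y)] {μ : Measure X} (c : X × Y → ℝ≥0∞) {L : Y → ℝ≥0∞}
    (hL : Measurable L)
    {H : Y × Y → ℝ≥0∞} (hH : Measurable H) {γ : ProbabilityMeasure (X × Y)}
    (hγ : (γ : Measure (X × Y)).map Prod.fst = μ) :
    continuumPotential μ c L H γ =
      ∫⁻ z, c z ∂(γ : Measure (X × Y)) + ∫⁻ z, L z.2 ∂(γ : Measure (X × Y))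
        + ∫⁻ z, ∫⁻ z', H (z.2, z'.2) ∂(γ : Measure (X × Y)) ∂(γ : Measure (X × Y)) := by
  have : IsProbabilityMeasure ((γ : Measure (X × Y)).map Prod.snd) :=
    Measure.isProbabilityMeasure_map measurable_snd.aemeasurable
  rw [continuumPotential, if_pos hγ, lintegral_map hL measurable_snd,
    lintegral_prod _ hH.aemeasurable,
    lintegral_map hH.lintegral_prod_right' measurable_snd]
  congr 1
  refine lintegral_congr fun z => ?_
  rw [lintegral_map (f := fun y => H (z.2, y)) (by fun_prop) measurable_snd]

end Energy

/-! ### Lower bound -/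

section Limit

variable {Ω X Y : Type*} [MeasurableSpace Ω]
  [TopologicalSpace X] [PolishSpace X] [MeasurableSpace X] [BorelSpace X]
  [TopologicalSpace Y] [PolishSpace Y] [MeasurableSpace Y] [BorelSpace Y]
  {P : Measure Ω} [IsProbabilityMeasure P] {μ : Measure X} [IsProbabilityMeasure μ]
  {ξ : ℕ → Ω → X}

/-- A plan which is a limit of induced plans with a growing number of players is almost surely
equal to its mean. -/
theorem ae_eq_mean_of_tendsto_inducedBy (hξ : ∀ i, Measurable (ξ i)) (hind : iIndepFun ξ P)
    {n : ℕ → ℕ} (hn : Tendsto n atTop atTop) {v : ℕ → RandomProb P (X × Y)}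
    {γ : RandomProb P (X × Y)} (hv : Tendsto v atTop (𝓝 γ)) {ν : ∀ k, Fin (n k) → Kernel X Y}
    (h : ∀ k, IsInducedBy ξ (ν k) (v k)) : ∀ᵐ ω ∂P, γ.toFun ω = γ.mean := by
  refine γ.ae_eq_mean fun A φ hA => ?_
  have h1 := (((tendsto_setIntegral_of_tendsto hv hA φ).sub
    ((ProbabilityMeasure.tendsto_iff_forall_integral_tendsto.1 (tendsto_mean hv) φ).const_mul
      (P.real A))).pow 2)
  have h2 : Tendsto (fun k => ‖φ‖ ^ 2 * (n k : ℝ)⁻¹) atTop (𝓝 (‖φ‖ ^ 2 * 0)) :=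
    (tendsto_inv_atTop_zero.comp (tendsto_natCast_atTop_atTop.comp hn)).const_mul _
  have h3 := le_of_tendsto_of_tendsto' h1 h2 fun k => (h k).sq_setIntegral_sub_le hξ hind φ hA
  rw [mul_zero] at h3
  exact sub_eq_zero.1 (pow_eq_zero_iff (two_ne_zero)|>.1 (le_antisymm h3 (sq_nonneg _)))

/-- Pushforward by the first projection is continuous, the means of the induced plans all project to
`μ`, and narrow limits are unique. -/
theorem map_fst_mean_of_tendsto_inducedBy (hξ : ∀ i, Measurable (ξ i))
    (hlaw : ∀ i, P.map (ξ i) = μ)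
    {n : ℕ → ℕ} {v : ℕ → RandomProb P (X × Y)}
    {γ : RandomProb P (X × Y)} (hv : Tendsto v atTop (𝓝 γ)) {ν : ∀ k, Fin (n k) → Kernel X Y}
    (h : ∀ k, IsInducedBy ξ (ν k) (v k)) : (γ.mean : Measure (X × Y)).map Prod.fst = μ := by
  have h1 := ((ProbabilityMeasure.continuous_map (Ω := X × Y) (Ω' := X)
    continuous_fst).tendsto γ.mean).comp (tendsto_mean hv)
  have h2 : ∀ k, (v k).mean.map continuous_fst.measurable.aemeasurable = ⟨μ, inferInstance⟩ :=
    fun k => Subtype.ext ((h k).map_fst_mean hξ hlaw)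
  have h3 := tendsto_nhds_unique h1 ((tendsto_congr h2).2 tendsto_const_nhds)
  exact congrArg Subtype.val h3

/-- The lower bound along sequences of induced plans with bounded cost. -/
theorem limitPotential_le_of_tendsto_inducedBy (hξ : ∀ i, Measurable (ξ i))
    (hind : iIndepFun ξ P) (hlaw : ∀ i, P.map (ξ i) = μ)
    {c : X × Y → ℝ≥0∞} (hc : LowerSemicontinuous c) {L : Y → ℝ≥0∞} (hL : LowerSemicontinuous L)
    {H : Y × Y → ℝ≥0∞} (hH : LowerSemicontinuous H)
    {n : ℕ → ℕ} (hn : Tendsto n atTop atTop) {v : ℕ → RandomProb P (X × Y)}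
    {γ : RandomProb P (X × Y)} (hv : Tendsto v atTop (𝓝 γ)) {ν : ∀ k, Fin (n k) → Kernel X Y}
    (h : ∀ k, IsInducedBy ξ (ν k) (v k)) {b : ℝ≥0∞}
    (hb : ∀ k, profileCost ξ c L H (ν k) (v k) ≤ b) : limitPotential μ c L H γ ≤ b := by
  have hμ := map_fst_mean_of_tendsto_inducedBy hξ hlaw hv h
  rw [limitPotential_of_ae_eq μ c L H γ γ.mean hμ (ae_eq_mean_of_tendsto_inducedBy hξ hind hn hv h),
    continuumPotential_eq c hL.measurable hH.measurable hμ]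
  -- The players' cost does not control `H` on the diagonal pairs, where it may be infinite;
  -- truncation makes their contribution `O(1 / n k)`.
  let G : ℕ → Y × Y → ℝ≥0∞ := fun j p => min (H p) j
  have hGlsc : ∀ j, LowerSemicontinuous (G j) := fun j =>
    hH.inf lowerSemicontinuous_const
  have hGm : ∀ j, Measurable (G j) := fun j => (hGlsc j).measurable
  have hGmono : Monotone G := fun i j hij p => min_le_min_left _ (by exact_mod_cast hij)
  have hsup : ∀ p, H p = ⨆ j, G j p := fun p => by
    simp only [G]
    rw [← inf_iSup_eq, ENNReal.iSup_natCast, inf_top_eq]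
  have hsupint : ∫⁻ z, ∫⁻ z', H (z.2, z'.2) ∂(γ.mean : Measure (X × Y))
      ∂(γ.mean : Measure (X × Y)) = ⨆ j, ∫⁻ z, ∫⁻ z', G j (z.2, z'.2)
        ∂(γ.mean : Measure (X × Y)) ∂(γ.mean : Measure (X × Y)) := by
    rw [← lintegral_iSup]
    · refine lintegral_congr fun z => ?_
      rw [← lintegral_iSup]
      · simp_rw [← hsup]
      · intro j
        exact (hGm j).comp (by fun_prop)
      · exact fun i j hij z' => hGmono hij _
    · intro j
      exact Measurable.lintegral_prod_right'
        (f := fun p : (X × Y) × (X × Y) => G j (p.1.2, p.2.2)) ((hGm j).comp (by fun_prop))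
    · exact fun i j hij z => lintegral_mono fun z' => hGmono hij _
  rw [hsupint, ENNReal.add_iSup]
  refine iSup_le fun j => ?_
  rw [← lintegral_prod_energy hc.measurable hL.measurable (hGm j)]
  have hprod : Tendsto (fun k => (v k).mean.prod (v k).mean) atTop
      (𝓝 (γ.mean.prod γ.mean)) :=
    (ProbabilityMeasure.continuous_prod.tendsto (γ.mean, γ.mean)).comp
      ((tendsto_mean hv).prodMk_nhds (tendsto_mean hv))
  have hlsc : LowerSemicontinuous fun p : (X × Y) × (X × Y) =>
      c p.1 + L p.1.2 + G j (p.1.2, p.2.2) :=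
    ((hc.comp continuous_fst).add (hL.comp (continuous_snd.comp continuous_fst))).add
      ((hGlsc j).comp (by fun_prop : Continuous fun p : (X × Y) × (X × Y) => (p.1.2, p.2.2)))
  refine (lintegral_le_liminf_of_lowerSemicontinuous hprod hlsc).trans ?_
  -- The error `j / n k` from the diagonal vanishes because `j` is fixed while `k → ∞`.
  have hlim : Tendsto (fun k => b + (j : ℝ≥0∞) * (n k : ℝ≥0∞)⁻¹) atTop (𝓝 b) := by
    have := (ENNReal.Tendsto.const_mul (a := (j : ℝ≥0∞))
      (ENNReal.tendsto_inv_nat_nhds_zero.comp hn)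
      (Or.inr (ENNReal.natCast_ne_top j))).const_add b
    simpa using this
  rw [← hlim.liminf_eq]
  refine liminf_le_liminf (Eventually.of_forall fun k => ?_)
  change ∫⁻ p : (X × Y) × (X × Y), (c p.1 + L p.1.2 + G j (p.1.2, p.2.2))
    ∂((v k).mean.prod (v k).mean : Measure ((X × Y) × (X × Y))) ≤ _
  rw [lintegral_prod_energy hc.measurable hL.measurable (hGm j)]
  refine le_trans ?_ (add_le_add_left (hb k) _)
  rw [profileCost_eq hξ hind hlaw hc.measurable hL.measurable hH.measurable (h k)]
  have hle : ∫⁻ z, ∫⁻ z', G j (z.2, z'.2) ∂((v k).mean : Measure (X × Y))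
      ∂((v k).mean : Measure (X × Y)) ≤
      ((n k : ℝ≥0∞) ^ 2)⁻¹ * ∑ i : Fin (n k), ∑ l ∈ Finset.univ.filter (fun l => l ≠ i),
          ∫⁻ z, ∫⁻ z', H (z.2, z'.2) ∂(μ ⊗ₘ ν k l) ∂(μ ⊗ₘ ν k i) + j * (n k : ℝ≥0∞)⁻¹ := by
    refine ((h k).lintegral_mean_mean_le hξ hlaw (hGm j) (C := j)
      fun p => min_le_right _ _).trans ?_
    gcongr
    exact min_le_left _ _
  exact (add_le_add_right hle _).trans (add_assoc _ _ _).ge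

end Limit

/-! ### Recovery sequences -/

section Recovery

/-- The law of large numbers for the plan in which every player uses the strategy `κ`. -/
theorem ae_tendsto_inducedPlan_real {Ω X Y : Type*} [MeasurableSpace Ω] [MeasurableSpace X]
    [MeasurableSpace Y] {P : Measure Ω} [IsProbabilityMeasure P] {μ : Measure X}
    [IsProbabilityMeasure μ] {ξ : ℕ → Ω → X} (hξ : ∀ i, Measurable (ξ i)) (hind : iIndepFun ξ P)
    (hlaw : ∀ i, P.map (ξ i) = μ) (κ : Kernel X Y) [IsMarkovKernel κ] {U : Set (X × Y)}
    (hU : MeasurableSet U) :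
    ∀ᵐ ω ∂P, Tendsto (fun N : ℕ => (inducedPlan ξ (fun _ : Fin N => κ) ω).real U) atTop
      (𝓝 ((μ ⊗ₘ κ).real U)) := by
  -- Given the sample, the plan's mass of `U` is the empirical average of `g`, whose `μ`-integral is
  -- the mass under `μ ⊗ₘ κ`.
  let g : X → ℝ := fun x => (κ x (Prod.mk x ⁻¹' U)).toReal
  have hgm' : Measurable fun x => κ x (Prod.mk x ⁻¹' U) := Kernel.measurable_kernel_prodMk_left hU
  have hgm : Measurable g := hgm'.ennreal_toReal
  have hslln := strong_law_ae_real (μ := P) (fun i ω => g (ξ i ω))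
    (Integrable.of_bound (hgm.comp (hξ 0)).aestronglyMeasurable 1
      (Eventually.of_forall fun ω => by
        rw [Real.norm_of_nonneg ENNReal.toReal_nonneg]
        exact ENNReal.toReal_le_of_le_ofReal zero_le_one (by simpa using prob_le_one)))
    (fun i j hij => (hind.indepFun hij).comp hgm hgm)
    (fun i => IdentDistrib.comp (f := ξ i) (g := ξ 0) (u := g)
      ⟨(hξ i).aemeasurable, (hξ 0).aemeasurable, (hlaw i).trans (hlaw 0).symm⟩ hgm)
  have hmean : ∫ ω, g (ξ 0 ω) ∂P = (μ ⊗ₘ κ).real U := by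
    rw [← integral_map (hξ 0).aemeasurable hgm.aestronglyMeasurable, hlaw 0,
      integral_toReal hgm'.aemeasurable (Eventually.of_forall fun x => measure_lt_top _ _),
      measureReal_def, Measure.compProd_apply hU]
  filter_upwards [hslln] with ω hω
  rw [hmean] at hω
  refine hω.congr fun N => ?_
  rw [measureReal_def, inducedPlan, Measure.smul_apply, Measure.finsetSum_apply, smul_eq_mul,
    ENNReal.toReal_mul, ENNReal.toReal_inv, ENNReal.toReal_natCast,
    ENNReal.toReal_sum fun i _ => measure_ne_top _ _, Finset.sum_range, div_eq_inv_mul]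
  congr 1
  refine Finset.sum_congr rfl fun i _ => ?_
  rw [Measure.prod_apply hU, lintegral_dirac' _ (measurable_measure_prodMk_left hU)]

variable {Ω X Y : Type*} [MeasurableSpace Ω]
  [TopologicalSpace X] [PolishSpace X] [MeasurableSpace X] [BorelSpace X]
  [TopologicalSpace Y] [PolishSpace Y] [MeasurableSpace Y] [BorelSpace Y]
  {P : Measure Ω}

theorem aestronglyMeasurable_integral_randomProb (w : RandomProb P (X × Y))
    {f : Ω → X × Y → ℝ} (hf : IsRandomBoundedContinuous P f) :
    AEStronglyMeasurable (fun ω => ∫ z, f ω z ∂(w.toFun ω : Measure (X × Y))) P := by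
  -- Continuity in `z` holds only almost surely; setting `f` to zero off a measurable set of full
  -- measure gives a Carathéodory function, which is jointly measurable.
  obtain ⟨T, hT, hTm, hTc⟩ := hf.ae_continuous.exists_measurable_mem
  let u : X × Y → Ω → ℝ := fun z => T.indicator fun ω => f ω z
  have hu : Measurable (Function.uncurry u) := by
    refine measurable_uncurry_of_continuous_of_measurable (fun ω => ?_)
      fun z => (hf.measurable z).indicator hTm
    by_cases hω : ω ∈ T
    · simpa [u, hω] using hTc ω hω
    · simpa [u, hω] using continuous_const
  have hs : StronglyMeasurable fun ω => ∫ z, u z ω ∂(w.kernel ω) :=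
    StronglyMeasurable.integral_kernel_prod_right' (f := fun p : Ω × (X × Y) => u p.2 p.1)
      (hu.comp measurable_swap).stronglyMeasurable
  refine ⟨_, hs, ?_⟩
  filter_upwards [hT] with ω hω
  simp [u, hω, w.kernel_apply]

/-- Almost sure narrow convergence to a deterministic plan implies narrow convergence of random
probability measures. -/
theorem tendsto_randomProb_of_ae_tendsto {w : ℕ → RandomProb P (X × Y)}
    {γ : RandomProb P (X × Y)}
    (h : ∀ᵐ ω ∂P, Tendsto (fun N => (w N).toFun ω) atTop (𝓝 (γ.toFun ω))) :
    Tendsto w atTop (𝓝 γ) := by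
  refine tendsto_randomProb_iff.2 fun f hf => ?_
  refine tendsto_integral_of_dominated_convergence (fun ω => ⨆ z, |f ω z|)
    (fun N => aestronglyMeasurable_integral_randomProb (w N) hf) hf.integrable_norm
    (fun N => ?_) ?_
  · filter_upwards [hf.ae_bounded] with ω ⟨C, hC⟩
    have := norm_integral_le_of_norm_le_const (μ := ((w N).toFun ω : Measure (X × Y)))
      (f := f ω) (C := ⨆ z, |f ω z|) (Eventually.of_forall fun z =>
        le_ciSup (f := fun z => |f ω z|) ⟨C, by rintro _ ⟨z, rfl⟩; exact hC z⟩ z)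
    simpa using this
  · filter_upwards [h, hf.ae_bounded, hf.ae_continuous] with ω hω ⟨C, hC⟩ hcont
    exact ProbabilityMeasure.tendsto_iff_forall_integral_tendsto.1 hω
      (BoundedContinuousFunction.ofNormedAddCommGroup (f ω) hcont C hC)

variable [IsProbabilityMeasure P] {μ : Measure X} [IsProbabilityMeasure μ]
  {ξ : ℕ → Ω → X}

theorem exists_randomProb_inducedPlan (P : Measure Ω) (hξ : ∀ i, Measurable (ξ i)) {N : ℕ}
    (hN : N ≠ 0) (ν : Fin N → Kernel X Y) [∀ i, IsMarkovKernel (ν i)] :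
    ∃ w : RandomProb P (X × Y), ∀ ω, (w.toFun ω : Measure (X × Y)) = inducedPlan ξ ν ω :=
  ⟨{ toFun := fun ω => ⟨inducedPlan ξ ν ω, isProbabilityMeasure_inducedPlan ξ hN ν ω⟩
     measurable_toFun := measurable_borel_probabilityMeasure fun _ hB =>
      measurable_inducedPlan_apply hξ ν hB }, fun _ => rfl⟩

/-- The exceptional null set in the law of large numbers depends on the test set; a countable family
of open sets suffices for narrow convergence, so the null sets can be united. -/
theorem ae_tendsto_inducedPlan (hξ : ∀ i, Measurable (ξ i)) (hind : iIndepFun ξ P)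
    (hlaw : ∀ i, P.map (ξ i) = μ) (κ : Kernel X Y) [IsMarkovKernel κ]
    {γ₀ : ProbabilityMeasure (X × Y)} (hγ₀ : μ ⊗ₘ κ = γ₀) {w : ℕ → RandomProb P (X × Y)}
    (hw : ∀ N ≠ 0, ∀ ω, ((w N).toFun ω : Measure (X × Y)) =
      inducedPlan ξ (fun _ : Fin N => κ) ω) :
    ∀ᵐ ω ∂P, Tendsto (fun N => (w N).toFun ω) atTop (𝓝 γ₀) := by
  obtain ⟨𝒰, h𝒰c, h𝒰o, h𝒰⟩ := exists_countable_inner_approx (Z := X × Y)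
  have hall : ∀ᵐ ω ∂P, ∀ U ∈ 𝒰,
      Tendsto (fun N : ℕ => (inducedPlan ξ (fun _ : Fin N => κ) ω).real U) atTop
        (𝓝 ((μ ⊗ₘ κ).real U)) :=
    (ae_ball_iff h𝒰c).2 fun U hU =>
      ae_tendsto_inducedPlan_real hξ hind hlaw κ (h𝒰o U hU).measurableSet
  filter_upwards [hall] with ω hω
  refine tendsto_of_inner_approx (h𝒰 γ₀) fun U hU r hr => ?_
  have h1 := hω U hU
  rw [hγ₀] at h1
  filter_upwards [h1.eventually_const_lt (NNReal.coe_lt_coe.2 hr), eventually_ne_atTop 0]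
    with N hN hN0
  rw [← hw N hN0 ω] at hN
  exact NNReal.coe_lt_coe.1 hN

/-- With identical strategies the mean is exactly `γ₀` and every off-diagonal pair contributes the
same energy, so the interaction carries the factor `N (N - 1) / N² ≤ 1`. -/
theorem profileCost_le_continuumPotential (hξ : ∀ i, Measurable (ξ i)) (hind : iIndepFun ξ P)
    (hlaw : ∀ i, P.map (ξ i) = μ) {c : X × Y → ℝ≥0∞} (hc : Measurable c) {L : Y → ℝ≥0∞}
    (hL : Measurable L) {H : Y × Y → ℝ≥0∞} (hH : Measurable H) {κ : Kernel X Y}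
    {γ₀ : ProbabilityMeasure (X × Y)} (hμ : (γ₀ : Measure (X × Y)).map Prod.fst = μ)
    (hγ₀ : μ ⊗ₘ κ = γ₀) {N : ℕ} {γ : RandomProb P (X × Y)}
    (h : IsInducedBy ξ (fun _ : Fin N => κ) γ) :
    profileCost ξ c L H (fun _ : Fin N => κ) γ ≤ continuumPotential μ c L H γ₀ := by
  have hN : (N : ℝ≥0∞) ≠ 0 := by exact_mod_cast h.ne_zero
  have hN' : (N : ℝ≥0∞) ≠ ∞ := ENNReal.natCast_ne_top N
  have hmean : (γ.mean : Measure (X × Y)) = γ₀ := by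
    rw [h.mean_eq hξ hlaw, hγ₀, Finset.sum_const, Finset.card_univ, Fintype.card_fin,
      ← Nat.cast_smul_eq_nsmul ℝ≥0∞, smul_smul, ENNReal.inv_mul_cancel hN hN', one_smul]
  rw [profileCost_eq hξ hind hlaw hc hL hH h, continuumPotential_eq c hL hH hμ, hmean, hγ₀]
  gcongr
  set E := ∫⁻ z, ∫⁻ z', H (z.2, z'.2) ∂(γ₀ : Measure (X × Y)) ∂(γ₀ : Measure (X × Y))
  calc ((N : ℝ≥0∞) ^ 2)⁻¹ * ∑ i : Fin N, ∑ j ∈ Finset.univ.filter (fun j => j ≠ i), E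
      ≤ ((N : ℝ≥0∞) ^ 2)⁻¹ * ∑ _i : Fin N, ∑ _j : Fin N, E := by
        gcongr
        exact Finset.filter_subset _ _
    _ = E := by
        simp only [Finset.sum_const, Finset.card_univ, Fintype.card_fin, nsmul_eq_mul]
        rw [← mul_assoc (N : ℝ≥0∞), ← pow_two, ← mul_assoc,
          ENNReal.inv_mul_cancel (pow_ne_zero 2 hN) (ENNReal.pow_ne_top hN'), one_mul]

/-- Recovery sequences: every player uses the conditional law of the limit plan. -/
theorem exists_recovery_sequence (hξ : ∀ i, Measurable (ξ i)) (hind : iIndepFun ξ P)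
    (hlaw : ∀ i, P.map (ξ i) = μ) {c : X × Y → ℝ≥0∞} (hc : Measurable c) {L : Y → ℝ≥0∞}
    (hL : Measurable L) {H : Y × Y → ℝ≥0∞} (hH : Measurable H) {γ : RandomProb P (X × Y)}
    {γ₀ : ProbabilityMeasure (X × Y)} (hμ : (γ₀ : Measure (X × Y)).map Prod.fst = μ)
    (hγ : ∀ᵐ ω ∂P, γ.toFun ω = γ₀) :
    ∃ u : ℕ → RandomProb P (X × Y), Tendsto u atTop (𝓝 γ) ∧
      ∀ N ≠ 0, openLoopPotential ξ c L H N (u N) ≤ continuumPotential μ c L H γ₀ := by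
  have : Nonempty Y := (nonempty_of_isProbabilityMeasure (γ₀ : Measure (X × Y))).map Prod.snd
  let κ : Kernel X Y := (γ₀ : Measure (X × Y)).condKernel
  have hγ₀ : μ ⊗ₘ κ = γ₀ := by
    rw [← hμ]
    exact (γ₀ : Measure (X × Y)).disintegrate κ
  have hex : ∀ N : ℕ, ∃ w : RandomProb P (X × Y), N ≠ 0 → ∀ ω,
      (w.toFun ω : Measure (X × Y)) = inducedPlan ξ (fun _ : Fin N => κ) ω := by
    intro N
    by_cases hN : N = 0
    -- The value at `N = 0`, where no plan is induced, is an arbitrary filler.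
    · exact ⟨γ, fun h => absurd hN h⟩
    · obtain ⟨w, hw⟩ := exists_randomProb_inducedPlan P hξ hN (fun _ : Fin N => κ)
      exact ⟨w, fun _ => hw⟩
  choose u hu using hex
  refine ⟨u, tendsto_randomProb_of_ae_tendsto ?_, fun N hN => ?_⟩
  · filter_upwards [ae_tendsto_inducedPlan hξ hind hlaw κ hγ₀ hu, hγ] with ω hω hγω
    rwa [hγω]
  · have hind' : IsInducedBy ξ (fun _ : Fin N => κ) (u N) :=
      ⟨fun _ => inferInstance, Eventually.of_forall (hu N hN)⟩
    exact iInf₂_le_of_le (fun _ : Fin N => κ) hind'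
      (profileCost_le_continuumPotential hξ hind hlaw hc hL hH hμ hγ₀ hind')

end Recovery

end OpenLoop

end

/-! ### The Γ-limit -/

theorem theorem4p4
    {Ω X Y : Type*} [MeasurableSpace Ω]
    [TopologicalSpace X] [PolishSpace X] [MeasurableSpace X] [BorelSpace X]
    [TopologicalSpace Y] [PolishSpace Y] [MeasurableSpace Y] [BorelSpace Y]
    (P : Measure Ω) [IsProbabilityMeasure P]
    (μ : Measure X) [IsProbabilityMeasure μ] [NullSingletonClass μ]
    (ξ : ℕ → Ω → X) (hξ_meas : ∀ i, Measurable (ξ i))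
    (hξ_indep : iIndepFun ξ P) (hξ_law : ∀ i, P.map (ξ i) = μ)
    (c : X × Y → ℝ≥0∞) (hc : LowerSemicontinuous c)
    (L : Y → ℝ≥0∞) (hL : LowerSemicontinuous L)
    (hL_compact : ∀ κ : ℝ≥0, 0 < κ → IsCompact {y | L y ≤ (κ : ℝ≥0∞)})
    (H : Y × Y → ℝ≥0∞) (hH : LowerSemicontinuous H)
    (hH_symm : ∀ y y' : Y, H (y, y') = H (y', y)) :
    OpenLoop.GammaConverges
      (fun (N : ℕ) (γ : OpenLoop.RandomProb P (X × Y)) =>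
        OpenLoop.openLoopPotential ξ c L H N γ)
      (fun γ : OpenLoop.RandomProb P (X × Y) =>
        OpenLoop.limitPotential μ c L H γ) := by
  refine ⟨fun γ u hu => ?_, fun γ => ?_⟩
  · refine le_of_forall_gt fun b hb => ?_
    -- Passing to the limit gives only a non-strict bound while the goal is strict, hence the
    -- intermediate `b'`. Along a subsequence the potential is below `b'`, so each infimum is
    -- attained up to `b'` by an inducing profile.
    obtain ⟨b', hb', hbb⟩ := exists_between hb
    refine lt_of_le_of_lt ?_ hbb
    obtain ⟨n, hn, hlt⟩ := extraction_of_frequently_atTop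
      (frequently_lt_of_liminf_lt (by isBoundedDefault) hb')
    have hex : ∀ k, ∃ ν : Fin (n k) → Kernel X Y, OpenLoop.IsInducedBy ξ ν (u (n k)) ∧
        OpenLoop.profileCost ξ c L H ν (u (n k)) < b' := by
      intro k
      have := hlt k
      simpa only [OpenLoop.openLoopPotential, iInf_lt_iff, exists_prop] using this
    choose ν hν hcost using hex
    exact OpenLoop.limitPotential_le_of_tendsto_inducedBy hξ_meas hξ_indep hξ_law hc hL hH
      hn.tendsto_atTop (hu.comp hn.tendsto_atTop) hν fun k => (hcost k).le
  · by_cases h : ∃ γ₀ : ProbabilityMeasure (X × Y),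
        (γ₀ : Measure (X × Y)).map Prod.fst = μ ∧ ∀ᵐ ω ∂P, γ.toFun ω = γ₀
    · obtain ⟨γ₀, hμ, hγ⟩ := h
      obtain ⟨u, hu, hle⟩ := OpenLoop.exists_recovery_sequence hξ_meas hξ_indep hξ_law
        hc.measurable hL.measurable hH.measurable hμ hγ
      refine ⟨u, hu, ?_⟩
      refine le_of_le_of_eq (limsup_le_of_le (by isBoundedDefault) ?_)
        (OpenLoop.limitPotential_of_ae_eq μ c L H γ γ₀ hμ hγ).symm
      filter_upwards [eventually_ne_atTop 0] with N hN using hle N hN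
    -- Here the limit functional is infinite, so any convergent sequence will do.
    · refine ⟨fun _ => γ, tendsto_const_nhds, ?_⟩
      exact le_of_le_of_eq le_top (OpenLoop.limitPotential_eq_top μ c L H γ h).symm
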